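/- **Setting.** A real-time energy automaton $A=(S,s_0,F,T,r)$ consists of a finite set $S$ of states, an initial state $s_0\in S$, a set $F\subseteq S$ of accepting states, a finite set $T\subseteq S\times(-\infty,0]\times[0,\infty)\times S$ of transitions $(s,p,b,s')$ with price $p$ and bound $b\ge -p$, and rates $r:S\to[0,\infty)$. A configuration is an element $(s,x,t)\in S\times[0,\infty]\times[0,\infty]$, and $(s,x,t)\leadsto(s',x',t')$ iff there are a delay $d\in[0,\infty]$ with $d+t'=t$ and a transition $(s,p,b,s')\in T$ such that $x+r(s)d\ge b$ and $x'=x+r(s)d+p$. Here and below $r\cdot\infty=\infty$ for all $r\ge 0$, including $r=0$ (infinite delay yields infinite energy). For finite $x,t$ this says that $t'\le t$, $x+(t-t')r(s)\ge b$ and $x'=x+(t-t')r(s)+p$. An infinite run is a sequence of configurations $c_0\leadsto c_1\leadsto\cdots$. Let $L=[0,\infty]\cup\{\bot\}$ with least element $\bot$. Let $\mathcal F$ be the set of monotone functions $f:L\times[0,\infty]\to L$ with $f(\bot,t)=\bot$ for all $t$, and let $\mathcal V$ be the set of monotone functions $v:L\times[0,\infty]\to\{\bot,\top\}$ with $v(\bot,t)=\bot$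 for all $t$; both are complete lattices with pointwise suprema. For $f\in\mathcal F$ and $g\in\mathcal F$ or $g\in\mathcal V$, put $(f\triangleright g)(x,t)=\bigvee_{t_1+t_2=t}g(f(x,t_1),t_2)$. Let $\mathbf 1(x,t)=x$. For $f_0,f_1,\dots\in\mathcal F$ let $\prod_{n\ge0}f_n\in\mathcal V$ be the function whose value at $(x,t)$ is $\top$ iff there are $t_0,t_1,\dots\in[0,\infty]$ with $\sum_n t_n=t$ such that, for all $n$, $f_n(\cdot,t_n)\circ\cdots\circ f_0(\cdot,t_0)$ maps $x$ to an element $\neq\bot$. The atomic function with rate $r$, bound $b$ and price $p$ is the $f\in\mathcal F$ with $f(\bot,t)=\bot$, $f(\infty,t)=\infty$, $f(x,\infty)=\infty$ for $x\ne\bot$, and, for $x,t\in[0,\infty)$, $f(x,t)=x+rt+p$ if $x+rt\ge b$ and $f(x,t)=\bot$ otherwise. For matrices over $\mathcal F$, products use $\bigvee$ as sum and $\triangleright$ as product (and likewise for matrices over $\mathcal F$ acting on vectors over $\mathcal V$). For a square matrix $M$ let $$M^*_{i,j}=\bigvee_{m\ge0}\ \bigvee_{k_0=i,\,k_1,\dots,k_{m-1},\,k_m=j}M_{k_0,k_1}\triangleright\cdots\triangleright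 M_{k_{m-1},k_m},\qquad M^\omega_i=\bigvee_{k_0=i,\,k_1,k_2,\dots}\ \prod_{n\ge0}M_{k_n,k_{n+1}},$$ where the product for $m=0$ is $\mathbf 1$ (and finite products along a path are bracketed from the left). The matrix representation of $A$ is as follows: $M_{s,s'}$ is the supremum of the atomic functions with rate $r(s)$, bound $b$ and price $p$ over all transitions $(s,p,b,s')\in T$; the initial vector $\alpha$ has $\alpha_{s_0}=\mathbf 1$ and $\alpha_s=\bot$ for $s\ne s_0$. Write $M=\begin{pmatrix}a&b\\c&d\end{pmatrix}$ in blocks, where $a$ is indexed by $F\times F$ and $d$ by $(S\setminus F)\times(S\setminus F)$. The Büchi behaviour of $A$ is $$\|A\|=\alpha\begin{pmatrix}(a\vee b\,d^*c)^\omega\\ d^*c\,(a\vee b\,d^*c)^\omega\end{pmatrix}\in\mathcal V .$$ **Theorem.** Let $A$ be a real-time energy automaton and $x_0,t\in[0,\infty]$. There exist $s\in F$ and an infinite run $(s_0,x_0,t)\leadsto(s_1,x_1,t_1)\leadsto\cdots$ in $A$ with $s_n=s$ for infinitely many $n\ge0$ if and only if $\|A\|(x_0,t)=\top$. -/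

import Mathlib

open scoped ENNReal NNReal

noncomputable section

/-! ## Real-time energy automata -/

/-- A real-time energy automaton on the set of states `S`. A transition `(s, p, b, s')` has price
`p ≤ 0` and bound `b ≥ 0`, and `b ≥ -p`. (Finiteness of `S` is asked for where it is used.) -/
structure RTEA (S : Type*) where
  init : S
  accepting : Set S
  transitions : Finset (S × ℝ × ℝ≥0 × S)
  rate : S → ℝ≥0
  price_nonpos : ∀ s p b s', (s, p, b, s') ∈ transitions → p ≤ 0
  neg_price_le_bound : ∀ s p b s', (s, p, b, s') ∈ transitions → -p ≤ (b : ℝ)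

/-- The energy gained by spending `d` time units at rate `r`: it is `r * d` for finite `d`, and
`∞` for `d = ∞`, whatever the rate. -/
def energyGain (r : ℝ≥0) (d : ℝ≥0∞) : ℝ≥0∞ :=
  if d = ∞ then ∞ else r * d

/-- Configurations `(s, x, t)`, with the energy `x` and the available time `t` in `[0, ∞]`. -/
abbrev RTEA.Config (S : Type*) : Type _ := S × ℝ≥0∞ × ℝ≥0∞

/-- The step relation `(s, x, t) ⇝ (s', x', t')`: a time `d` is spent in `s`, where `t = d + t'`,
and a transition `(s, p, b, s')` is taken, which needs `x + (gain in s) ≥ b` and leads to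
`x' = x + (gain in s) + p`; this equation is written as `x' + (-p) = x + (gain in s)`, as
`p ≤ 0`. On configurations with finite `x` and `t` this is spelled out over the real numbers in
`RTEA.step_coe_iff` below. -/
def RTEA.Step {S : Type*} (A : RTEA S) (c c' : RTEA.Config S) : Prop :=
  ∃ d : ℝ≥0∞, d + c'.2.2 = c.2.2 ∧
    ∃ (p : ℝ) (b : ℝ≥0), (c.1, p, b, c'.1) ∈ A.transitions ∧
      (b : ℝ≥0∞) ≤ c.2.1 + energyGain (A.rate c.1) d ∧
      c'.2.1 + ENNReal.ofReal (-p) = c.2.1 + energyGain (A.rate c.1) d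

/-- Infinite runs: infinite paths in the graph of configurations. -/
def RTEA.IsInfiniteRun {S : Type*} (A : RTEA S) (c : ℕ → RTEA.Config S) : Prop :=
  ∀ n, A.Step (c n) (c (n + 1))

/-- On finite configurations, steps are given by `t' ≤ t` and a transition `(s, p, b, s')` with
`x + (t - t') r(s) ≥ b` and `x' = x + (t - t') r(s) + p`, as an equivalence over the reals. -/
theorem RTEA.step_coe_iff {S : Type*} (A : RTEA S) (s s' : S) (x t x' t' : ℝ≥0) :
    A.Step (s, (x : ℝ≥0∞), (t : ℝ≥0∞)) (s', (x' : ℝ≥0∞), (t' : ℝ≥0∞)) ↔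
      t' ≤ t ∧ ∃ (p : ℝ) (b : ℝ≥0), (s, p, b, s') ∈ A.transitions ∧
        (b : ℝ) ≤ x + ((t : ℝ) - t') * A.rate s ∧
        (x' : ℝ) = x + ((t : ℝ) - t') * A.rate s + p := by
  have key : ∀ (d : ℝ≥0) (p : ℝ) (b : ℝ≥0), d + t' = t → p ≤ 0 →
      ((((b : ℝ≥0∞) ≤ x + energyGain (A.rate s) d ∧
        (x' : ℝ≥0∞) + ENNReal.ofReal (-p) = x + energyGain (A.rate s) d)) ↔
      ((b : ℝ) ≤ x + ((t : ℝ) - t') * A.rate s ∧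
        (x' : ℝ) = x + ((t : ℝ) - t') * A.rate s + p)) := by
    intro d p b hd hp
    have hd' : (t : ℝ) - t' = d := by rw [← hd]; push_cast; ring
    rw [hd', energyGain, if_neg ENNReal.coe_ne_top, ENNReal.ofReal]
    norm_cast
    rw [← NNReal.coe_le_coe, ← NNReal.coe_inj]
    push_cast
    rw [Real.coe_toNNReal _ (by linarith)]
    constructor <;> rintro ⟨h1, h2⟩ <;> constructor <;> linarith
  constructor
  · rintro ⟨d, hd, p, b, hT, h⟩
    simp only at hd hT h
    lift d to ℝ≥0 using by rintro rfl; simp at hd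
    have hd' : d + t' = t := by exact_mod_cast hd
    exact ⟨hd' ▸ le_add_self, p, b, hT, (key d p b hd' (A.price_nonpos _ _ _ _ hT)).1 h⟩
  · rintro ⟨ht, p, b, hT, h⟩
    have hd' : (t - t') + t' = t := tsub_add_cancel_of_le ht
    exact ⟨((t - t' : ℝ≥0) : ℝ≥0∞), by simp only; exact_mod_cast hd', p, b, hT,
      (key _ p b hd' (A.price_nonpos _ _ _ _ hT)).2 h⟩

/-! ## The lattices of energy functions and of infinite behaviours -/

/-- `L = [0, ∞]` with an additional least element `⊥`. -/
abbrev EnergyLevel : Type := WithBot ℝ≥0∞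

/-- The set `𝓕` of monotone functions `f : L × [0, ∞] → L` with `f (⊥, t) = ⊥`. -/
@[ext]
structure EnergyFun where
  toFun : EnergyLevel → ℝ≥0∞ → EnergyLevel
  mono' : ∀ x y s t, x ≤ y → s ≤ t → toFun x s ≤ toFun y t
  map_bot' : ∀ t, toFun ⊥ t = ⊥

namespace EnergyFun

instance : CoeFun EnergyFun (fun _ => EnergyLevel → ℝ≥0∞ → EnergyLevel) := ⟨toFun⟩

/-- The pointwise order. -/
instance : PartialOrder EnergyFun :=
  PartialOrder.lift toFun (fun _ _ h => EnergyFun.ext h)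

/-- Suprema are pointwise. -/
instance : SupSet EnergyFun where
  sSup X :=
    { toFun := fun x t => ⨆ f ∈ X, f x t
      mono' := fun _ _ _ _ hx ht => iSup₂_mono fun f _ => f.mono' _ _ _ _ hx ht
      map_bot' := fun t => by simp [map_bot'] }

instance : CompleteLattice EnergyFun :=
  completeLatticeOfSup _ fun X =>
    ⟨fun f hf x t => le_iSup₂ (f := fun (g : EnergyFun) (_ : g ∈ X) => g x t) f hf,
      fun _ hg x t => iSup₂_le fun _ hf => hg hf x t⟩

theorem sSup_apply (X : Set EnergyFun) (x : EnergyLevel) (t : ℝ≥0∞) :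
    sSup X x t = ⨆ f ∈ X, f x t := rfl

theorem iSup_apply {ι : Sort*} (f : ι → EnergyFun) (x : EnergyLevel) (t : ℝ≥0∞) :
    (⨆ i, f i) x t = ⨆ i, f i x t := by
  rw [iSup, sSup_apply, iSup_range]

theorem sup_apply (f g : EnergyFun) (x : EnergyLevel) (t : ℝ≥0∞) :
    (f ⊔ g) x t = f x t ⊔ g x t := by
  rw [← sSup_pair, sSup_apply, iSup_pair]

/-- The function `𝟏 (x, t) = x`. -/
def one : EnergyFun where
  toFun x _ := x
  mono' _ _ _ _ hx _ := hx
  map_bot' _ := rfl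

theorem bot_apply (x : EnergyLevel) (t : ℝ≥0∞) : (⊥ : EnergyFun) x t = ⊥ := by
  rw [← sSup_empty, sSup_apply]; simp

/-- Composition (in diagrammatic order):
`(f ▹ g) (x, t) = ⨆ t₁ + t₂ = t, g (f (x, t₁), t₂)`. -/
def comp (f g : EnergyFun) : EnergyFun where
  toFun x t := ⨆ (t₁ : ℝ≥0∞) (t₂ : ℝ≥0∞) (_ : t₁ + t₂ = t), g (f x t₁) t₂
  mono' x y s t hx ht := by
    refine iSup_le fun t₁ => iSup_le fun t₂ => iSup_le fun h => ?_
    refine le_trans ?_ (le_iSup_of_le t₁ (le_iSup_of_le (t₂ + (t - s)) (le_iSup_of_le ?_ le_rfl)))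
    · exact g.mono' _ _ _ _ (f.mono' _ _ _ _ hx le_rfl) le_self_add
    · rw [← add_assoc, h, add_tsub_cancel_of_le ht]
  map_bot' t := by simp [map_bot']

/-- The atomic real-time energy function with rate `r`, bound `b` and price `p` (used for
`p ≤ 0` and `b ≥ -p`, so that the subtraction of `-p` below never truncates). For `x` and `t` in
`[0, ∞)` its value is `x + r t + p` if `x + r t ≥ b`, and `⊥` otherwise. Moreover
`f (⊥, t) = ⊥`, `f (∞, t) = ∞`, and `f (x, ∞) = ∞` for `x ≠ ⊥`. -/
def atomic (r b : ℝ≥0) (p : ℝ) : EnergyFun where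
  toFun
    | ⊥, _ => ⊥
    | (x : ℝ≥0∞), t =>
      if (b : ℝ≥0∞) ≤ x + energyGain r t then
        ((x + energyGain r t - ENNReal.ofReal (-p) : ℝ≥0∞) : EnergyLevel)
      else ⊥
  mono' x y s t hx ht := by
    have hgain : energyGain r s ≤ energyGain r t := by
      unfold energyGain
      split_ifs with h1 h2
      · exact le_rfl
      · exact absurd (top_le_iff.1 (h1 ▸ ht)) h2
      · exact le_top
      · gcongr
    induction x using WithBot.recBotCoe with
    | bot => exact bot_le
    | coe x =>
      induction y using WithBot.recBotCoe with
      | bot => simp at hx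
      | coe y =>
        have hxy : x + energyGain r s ≤ y + energyGain r t :=
          add_le_add (WithBot.coe_le_coe.1 hx) hgain
        simp only
        split_ifs with h1 h2
        · exact WithBot.coe_le_coe.2 (tsub_le_tsub_right hxy _)
        · exact absurd (h1.trans hxy) h2
        · exact bot_le
        · exact le_rfl
  map_bot' _ := rfl

end EnergyFun

/-- The set `𝓐` of atomic real-time energy functions. -/
def atomicEnergyFuns : Set EnergyFun :=
  {f | ∃ (r b : ℝ≥0) (p : ℝ), p ≤ 0 ∧ -p ≤ (b : ℝ) ∧ f = EnergyFun.atomic r b p}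

/-- The set `𝓥` of monotone functions `v : L × [0, ∞] → 𝔹` with `v (⊥, t) = ⊥`. The Boolean
lattice `𝔹` is the lattice of propositions, with `⊥ = False` and `⊤ = True`. -/
@[ext]
structure InfBehaviour where
  toFun : EnergyLevel → ℝ≥0∞ → Prop
  mono' : ∀ x y s t, x ≤ y → s ≤ t → toFun x s ≤ toFun y t
  map_bot' : ∀ t, toFun ⊥ t = ⊥

namespace InfBehaviour

instance : CoeFun InfBehaviour (fun _ => EnergyLevel → ℝ≥0∞ → Prop) := ⟨toFun⟩

/-- The pointwise order. -/
instance : PartialOrder InfBehaviour :=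
  PartialOrder.lift toFun (fun _ _ h => InfBehaviour.ext h)

/-- Suprema are pointwise. -/
instance : SupSet InfBehaviour where
  sSup X :=
    { toFun := fun x t => ⨆ v ∈ X, v x t
      mono' := fun _ _ _ _ hx ht => iSup₂_mono fun v _ => v.mono' _ _ _ _ hx ht
      map_bot' := fun t => by simp [map_bot'] }

instance : CompleteLattice InfBehaviour :=
  completeLatticeOfSup _ fun X =>
    ⟨fun f hf x t => le_iSup₂ (f := fun (g : InfBehaviour) (_ : g ∈ X) => g x t) f hf,
      fun _ hg x t => iSup₂_le fun _ hf => hg hf x t⟩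

theorem sSup_apply (X : Set InfBehaviour) (x : EnergyLevel) (t : ℝ≥0∞) :
    sSup X x t = ⨆ v ∈ X, v x t := rfl

theorem iSup_apply {ι : Sort*} (v : ι → InfBehaviour) (x : EnergyLevel) (t : ℝ≥0∞) :
    (⨆ i, v i) x t = ⨆ i, v i x t := by
  rw [iSup, sSup_apply, iSup_range]

end InfBehaviour

namespace EnergyFun

/-- The left action of `𝓕` on `𝓥`: `(f ▹ v) (x, t) = ⨆ t₁ + t₂ = t, v (f (x, t₁), t₂)`. -/
def act (f : EnergyFun) (v : InfBehaviour) : InfBehaviour where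
  toFun x t := ⨆ (t₁ : ℝ≥0∞) (t₂ : ℝ≥0∞) (_ : t₁ + t₂ = t), v (f x t₁) t₂
  mono' x y s t hx ht := by
    refine iSup_le fun t₁ => iSup_le fun t₂ => iSup_le fun h => ?_
    refine le_trans ?_ (le_iSup_of_le t₁ (le_iSup_of_le (t₂ + (t - s)) (le_iSup_of_le ?_ le_rfl)))
    · exact v.mono' _ _ _ _ (f.mono' _ _ _ _ hx le_rfl) le_self_add
    · rw [← add_assoc, h, add_tsub_cancel_of_le ht]
  map_bot' t := by simp [map_bot', InfBehaviour.map_bot']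

/-- The energy level `f_{n-1}(t_{n-1}) ∘ ⋯ ∘ f_0(t_0) (x)` after the first `n` functions. -/
def prefixValue (f : ℕ → EnergyFun) (u : ℕ → ℝ≥0∞) (x : EnergyLevel) : ℕ → EnergyLevel
  | 0 => x
  | n + 1 => f n (prefixValue f u x n) (u n)

theorem prefixValue_mono (f : ℕ → EnergyFun) {u v : ℕ → ℝ≥0∞} {x y : EnergyLevel}
    (hx : x ≤ y) (huv : ∀ n, u n ≤ v n) (n : ℕ) :
    prefixValue f u x n ≤ prefixValue f v y n := by
  induction n with
  | zero => exact hx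
  | succ n ih => exact (f n).mono' _ _ _ _ ih (huv n)

/-- The infinite product `∏ f_n ∈ 𝓥`: it is true at `(x, t)` iff there are `t_0, t_1, … ∈ [0, ∞]`
with `∑ t_n = t` such that `f_n(t_n) ∘ ⋯ ∘ f_0(t_0) (x) ≠ ⊥` for all `n ≥ 0`. -/
def infProd (f : ℕ → EnergyFun) : InfBehaviour where
  toFun x t := ∃ u : ℕ → ℝ≥0∞, ∑' n, u n = t ∧ ∀ n, prefixValue f u x (n + 1) ≠ ⊥
  mono' x y s t hx ht := by
    rintro ⟨u, hu, h⟩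
    refine ⟨fun n => u n + if n = 0 then t - s else 0, ?_, fun n => ?_⟩
    · rw [ENNReal.tsum_add, tsum_ite_eq, hu, add_tsub_cancel_of_le ht]
    · exact ne_bot_of_le_ne_bot (h n)
        (prefixValue_mono f hx (fun _ => le_self_add) (n + 1))
  map_bot' t := by
    refine eq_bot_iff.2 ?_
    rintro ⟨u, -, h⟩
    exact h 0 (map_bot' _ _)

end EnergyFun

/-! ## Matrix operations

Suprema and compositions of matrix entries are those of `𝓕` and `𝓥`. -/

namespace EnergyMatrix

open EnergyFun

variable {ι κ μ : Type*}

/-- The matrix product, `(M N)_{i,j} = ⨆ k, M_{i,k} ▹ N_{k,j}`. -/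
def mul (M : Matrix ι κ EnergyFun) (N : Matrix κ μ EnergyFun) : Matrix ι μ EnergyFun :=
  fun i j => ⨆ k, (M i k).comp (N k j)

/-- The matrix-vector product, `(M v)_i = ⨆ k, M_{i,k} ▹ v_k`. -/
def mulVec (M : Matrix ι κ EnergyFun) (v : κ → InfBehaviour) : ι → InfBehaviour :=
  fun i => ⨆ k, (M i k).act (v k)

/-- The product `M_{k_0,k_1} ▹ ⋯ ▹ M_{k_{m-1},k_m}` along a path with `m` edges; it is `𝟏` for
`m = 0`. -/
def pathProd (M : Matrix ι ι EnergyFun) (k : ℕ → ι) : ℕ → EnergyFun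
  | 0 => one
  | m + 1 => (pathProd M k m).comp (M (k m) (k (m + 1)))

/-- The matrix `M^*`: its entry at `(i, j)` is the supremum of the products of the labels along all
finite paths from `i` to `j`. (Only the first `m + 1` values of the sequence `k` matter.) -/
def star (M : Matrix ι ι EnergyFun) : Matrix ι ι EnergyFun :=
  fun i j => ⨆ (m : ℕ) (k : ℕ → ι) (_ : k 0 = i) (_ : k m = j), pathProd M k m

/-- The vector `M^ω`: its entry at `i` is the supremum of the infinite products
`M_{k_0,k_1} M_{k_1,k_2} ⋯` over all infinite paths `k_0, k_1, …` with `k_0 = i`. -/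
def omega (M : Matrix ι ι EnergyFun) : ι → InfBehaviour :=
  fun i => ⨆ (k : ℕ → ι) (_ : k 0 = i), infProd fun n => M (k n) (k (n + 1))

end EnergyMatrix

/-! ## Weighted automata -/

/-- A weighted automaton `(α, M, K)` over a set `X` of energy functions, with the states indexed by
`ι` (instead of `{1, …, n}`) and an arbitrary set `K` of accepting states (instead of
`{1, …, k}`). The entries of the initial vector `α` are `⊥` or `𝟏`, and those of the transition
matrix `M` are finite suprema of elements of `X`. -/
structure WeightedAutomaton (X : Set EnergyFun) (ι : Type*) where
  α : ι → EnergyFun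
  M : Matrix ι ι EnergyFun
  K : Set ι
  α_mem : ∀ i, α i = ⊥ ∨ α i = EnergyFun.one
  M_mem : ∀ i j, ∃ Y : Set EnergyFun, Y.Finite ∧ Y ⊆ X ∧ M i j = sSup Y

namespace WeightedAutomaton

open EnergyMatrix

variable {X : Set EnergyFun} {ι : Type*} (A : WeightedAutomaton X ι)

/-- The block of `M` for transitions from accepting to accepting states. -/
def a : Matrix A.K A.K EnergyFun := fun i j => A.M i j

/-- The block of `M` for transitions from accepting to non-accepting states. -/
def b : Matrix A.K (A.Kᶜ : Set ι) EnergyFun := fun i j => A.M i j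

/-- The block of `M` for transitions from non-accepting to accepting states. -/
def c : Matrix (A.Kᶜ : Set ι) A.K EnergyFun := fun i j => A.M i j

/-- The block of `M` for transitions from non-accepting to non-accepting states. -/
def d : Matrix (A.Kᶜ : Set ι) (A.Kᶜ : Set ι) EnergyFun := fun i j => A.M i j

/-- The matrix `a ∨ b d^* c` on the accepting states. -/
def returnMatrix : Matrix A.K A.K EnergyFun :=
  fun i j => A.a i j ⊔ mul (mul A.b (star A.d)) A.c i j

/-- The column vector with the two blocks `(a ∨ b d^* c)^ω` and `d^* c (a ∨ b d^* c)^ω`. -/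
def buchiVec : ι → InfBehaviour := by
  classical
  exact fun i =>
    if h : i ∈ A.K then omega A.returnMatrix ⟨i, h⟩
    else mulVec (mul (star A.d) A.c) (omega A.returnMatrix) ⟨i, h⟩

/-- The Büchi behaviour `‖A‖`, the product of the row vector `α` and the column vector above. -/
def buchiBehaviour : InfBehaviour := ⨆ i, (A.α i).act (A.buchiVec i)

end WeightedAutomaton

/-- The matrix representation of a real-time energy automaton: `α` is `𝟏` at the initial state and
`⊥` elsewhere, `M_{s,s'}` is the supremum of the atomic functions of all transitions from `s` to
`s'`, and the accepting states are the same. -/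
def RTEA.toWeightedAutomaton {S : Type*} (A : RTEA S) :
    WeightedAutomaton atomicEnergyFuns S where
  α := by
    classical
    exact fun s => if s = A.init then EnergyFun.one else ⊥
  M := fun s s' =>
    ⨆ (p : ℝ) (b : ℝ≥0) (_ : (s, p, b, s') ∈ A.transitions), EnergyFun.atomic (A.rate s) b p
  K := A.accepting
  α_mem s := by
    by_cases h : s = A.init <;> simp [h]
  M_mem s s' := by
    refine ⟨{f | ∃ (p : ℝ) (b : ℝ≥0), (s, p, b, s') ∈ A.transitions ∧
      f = EnergyFun.atomic (A.rate s) b p}, ?_, ?_, ?_⟩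
    · refine (A.transitions.finite_toSet.image
        fun τ => EnergyFun.atomic (A.rate s) τ.2.2.1 τ.2.1).subset ?_
      rintro f ⟨p, b, h, rfl⟩
      exact ⟨(s, p, b, s'), h, rfl⟩
    · rintro f ⟨p, b, h, rfl⟩
      exact ⟨_, b, p, A.price_nonpos _ _ _ _ h, A.neg_price_le_bound _ _ _ _ h, rfl⟩
    · refine le_antisymm ?_ ?_
      · refine iSup_le fun p => iSup_le fun b => iSup_le fun h => le_sSup ⟨p, b, h, rfl⟩
      · refine sSup_le ?_
        rintro f ⟨p, b, h, rfl⟩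
        exact le_iSup_of_le p (le_iSup_of_le b (le_iSup_of_le h le_rfl))

end

open scoped ENNReal NNReal

/-! ## Closed relations between energy, time and energy -/

/-! A run visiting accepting states infinitely often gives the Büchi behaviour directly: cut it at
those visits, read each segment as a path in `a` or in `b d^* c`, and bound the matrix entries below
by path products. The time used by the segments may sum to less than `t`; monotonicity in time fills
the gap.

The converse is the difficult direction. The entries of the return matrix are suprema over
splittings of time and over paths of unbounded length, and it must be shown that every value of such
a supremum is reached by an actual run. The tool is compactness of `[0, ∞]`: if the hypographs of a
family lie in a closed, downward closed relation, so does that of its supremum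
(`EnergyFun.mem_of_le_iSup`), and such relations are stable under composition and finite unions. So
it suffices that reachability through a given set of states is a closed relation between energy,
time and energy.

This is `RTEA.isHypo_reachSet`, by induction on the set of states in order of increasing rate. As
prices are nonpositive, a loop at a state of greatest rate gains no more than waiting there for the
same time, so that state need be left only once (`RTEA.reachSet_insert`), and reachability becomes a
finite union of compositions of closed relations.

Each factor of an infinite product is then realised by a nonempty run between accepting states with
at least the predicted energy. These runs are chained, and finiteness of the state set singles out
one accepting state that recurs. -/

/-- A set of triples `(x, t, y)` that is closed and downward closed in `y`. -/
structure IsHypo (R : Set (ℝ≥0∞ × ℝ≥0∞ × ℝ≥0∞)) : Prop where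
  isClosed : IsClosed R
  anti : ∀ {x t y y'}, y' ≤ y → (x, t, y) ∈ R → (x, t, y') ∈ R

/-- The composition of two relations, in which the times add up. -/
def relComp (R R' : Set (ℝ≥0∞ × ℝ≥0∞ × ℝ≥0∞)) : Set (ℝ≥0∞ × ℝ≥0∞ × ℝ≥0∞) :=
  {w | ∃ y t₁ t₂, t₁ + t₂ = w.2.1 ∧ (w.1, t₁, y) ∈ R ∧ (y, t₂, w.2.2) ∈ R'}

/-- The matching pairs of triples form a closed subset of a compact space, and the composition is
its image under a continuous map, addition being continuous on `[0, ∞]`. -/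
theorem IsHypo.comp {R R' : Set (ℝ≥0∞ × ℝ≥0∞ × ℝ≥0∞)} (h : IsHypo R) (h' : IsHypo R') :
    IsHypo (relComp R R') := by
  refine ⟨?_, ?_⟩
  · let P : Set ((ℝ≥0∞ × ℝ≥0∞ × ℝ≥0∞) × (ℝ≥0∞ × ℝ≥0∞ × ℝ≥0∞)) :=
      {q | q.1 ∈ R ∧ q.2 ∈ R' ∧ q.1.2.2 = q.2.1}
    have hP : IsClosed P :=
      (h.isClosed.preimage continuous_fst).inter ((h'.isClosed.preimage continuous_snd).inter
        (isClosed_eq (by fun_prop) (by fun_prop)))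
    have himg : relComp R R' = (fun q => (q.1.1, q.1.2.1 + q.2.2.1, q.2.2.2)) '' P := by
      ext ⟨x, t, z⟩
      constructor
      · rintro ⟨y, t₁, t₂, ht, h1, h2⟩
        exact ⟨((x, t₁, y), (y, t₂, z)), ⟨h1, h2, rfl⟩, by simpa using ht⟩
      · rintro ⟨⟨⟨x', t₁, y⟩, ⟨y', t₂, z'⟩⟩, ⟨h1, h2, h3⟩, h4⟩
        simp only [Prod.mk.injEq] at h3 h4
        obtain ⟨rfl, rfl, rfl⟩ := h4
        subst h3
        exact ⟨_, t₁, t₂, rfl, h1, h2⟩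
    rw [himg]
    exact (hP.isCompact.image (by fun_prop)).isClosed
  · rintro x t z z' hz ⟨y, t₁, t₂, ht, h1, h2⟩
    exact ⟨y, t₁, t₂, ht, h1, h'.anti hz h2⟩

theorem IsHypo.union {R R' : Set (ℝ≥0∞ × ℝ≥0∞ × ℝ≥0∞)} (h : IsHypo R) (h' : IsHypo R') :
    IsHypo (R ∪ R') :=
  ⟨h.isClosed.union h'.isClosed, fun hy => Or.imp (h.anti hy) (h'.anti hy)⟩

theorem IsHypo.iUnion {ι : Type*} [Finite ι] {R : ι → Set (ℝ≥0∞ × ℝ≥0∞ × ℝ≥0∞)}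
    (h : ∀ i, IsHypo (R i)) : IsHypo (⋃ i, R i) := by
  refine ⟨isClosed_iUnion_of_finite fun i => (h i).isClosed, fun hy hR => ?_⟩
  obtain ⟨i, hi⟩ := Set.mem_iUnion.1 hR
  exact Set.mem_iUnion.2 ⟨i, (h i).anti hy hi⟩

/-! ### Hypographs of energy functions inside closed relations -/

namespace EnergyFun

/-- The hypograph of `f` over `[0, ∞] × [0, ∞]` is contained in `R`. -/
def HypoIn (f : EnergyFun) (R : Set (ℝ≥0∞ × ℝ≥0∞ × ℝ≥0∞)) : Prop :=
  ∀ x t y : ℝ≥0∞, (y : EnergyLevel) ≤ f x t → (x, t, y) ∈ R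

/-- If `D` is closed and downward closed, and contains every level below some `f i`, then it
contains every level below `⨆ i, f i`. -/
theorem mem_of_le_iSup {ι : Sort*} {f : ι → EnergyLevel} {D : Set ℝ≥0∞} (hD : IsClosed D)
    (hanti : ∀ y ∈ D, ∀ y' ≤ y, y' ∈ D) (h : ∀ i (y : ℝ≥0∞), (y : EnergyLevel) ≤ f i → y ∈ D)
    {y : ℝ≥0∞} (hy : (y : EnergyLevel) ≤ ⨆ i, f i) : y ∈ D := by
  -- An empty `D` has no greatest element; in that case every `f i` is `⊥`.
  rcases D.eq_empty_or_nonempty with rfl | hne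
  · have : ⨆ i, f i = ⊥ := by
      refine iSup_eq_bot.2 fun i => ?_
      induction hf : f i using WithBot.recBotCoe with
      | bot => rfl
      | coe z => exact (h i z hf.ge).elim
    rw [this] at hy
    simp at hy
  -- By compactness `D` has a greatest element, which bounds every `f i` and hence the supremum.
  · obtain ⟨m, hm, hmax⟩ := hD.isCompact.exists_isGreatest hne
    refine hanti m hm y (WithBot.coe_le_coe.1 (hy.trans (iSup_le fun i => ?_)))
    induction hf : f i using WithBot.recBotCoe with
    | bot => exact bot_le
    | coe z => exact WithBot.coe_le_coe.2 (hmax (h i z hf.ge))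

theorem HypoIn.mono {f : EnergyFun} {R R' : Set (ℝ≥0∞ × ℝ≥0∞ × ℝ≥0∞)} (h : f.HypoIn R)
    (hR : R ⊆ R') : f.HypoIn R' :=
  fun x t y hy => hR (h x t y hy)

theorem HypoIn.iSup {ι : Sort*} {f : ι → EnergyFun} {R : Set (ℝ≥0∞ × ℝ≥0∞ × ℝ≥0∞)}
    (hR : IsHypo R) (h : ∀ i, (f i).HypoIn R) : (⨆ i, f i).HypoIn R := by
  intro x t y hy
  rw [iSup_apply] at hy
  exact mem_of_le_iSup (D := {y | (x, t, y) ∈ R}) (hR.isClosed.preimage (by fun_prop))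
    (fun _ hy _ hy' => hR.anti hy' hy) (fun i y hy => h i x t y hy) hy

theorem HypoIn.comp {f g : EnergyFun} {R R' : Set (ℝ≥0∞ × ℝ≥0∞ × ℝ≥0∞)} (hR : IsHypo R)
    (hR' : IsHypo R') (hf : f.HypoIn R) (hg : g.HypoIn R') :
    (f.comp g).HypoIn (relComp R R') := by
  intro x t z hz
  have hc := hR.comp hR'
  let D : Set ℝ≥0∞ := {z | (x, t, z) ∈ relComp R R'}
  have hD : IsClosed D := hc.isClosed.preimage (by fun_prop)
  have hanti : ∀ y ∈ D, ∀ y' ≤ y, y' ∈ D := fun _ hy _ hy' => hc.anti hy' hy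
  -- One application for each of the three nested suprema: over `t₁`, over `t₂` and over the proof
  -- of `t₁ + t₂ = t`.
  refine mem_of_le_iSup hD hanti (fun t₁ _ => mem_of_le_iSup hD hanti
    (fun t₂ _ => mem_of_le_iSup hD hanti fun ht z hz => ?_)) hz
  induction hy : f x t₁ using WithBot.recBotCoe with
  | bot => simp [hy, g.map_bot'] at hz
  | coe y => exact ⟨y, t₁, t₂, ht, hf _ _ _ hy.ge, hg _ _ _ (hy ▸ hz)⟩

theorem le_comp {f g : EnergyFun} {x y z : EnergyLevel} {t₁ t₂ : ℝ≥0∞} (hf : y ≤ f x t₁)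
    (hg : z ≤ g y t₂) : z ≤ f.comp g x (t₁ + t₂) :=
  (hg.trans (g.mono' _ _ _ _ hf le_rfl)).trans
    (le_iSup_of_le t₁ (le_iSup_of_le t₂ (le_iSup_of_le rfl le_rfl)))

theorem act_apply {f : EnergyFun} {v : InfBehaviour} {x : EnergyLevel} {t : ℝ≥0∞} :
    f.act v x t ↔ ∃ t₁ t₂, t₁ + t₂ = t ∧ v (f x t₁) t₂ := by
  simp [act]

theorem one_act {v : InfBehaviour} {x : EnergyLevel} {t : ℝ≥0∞} : one.act v x t ↔ v x t := by
  rw [act_apply]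
  constructor
  · rintro ⟨t₁, t₂, rfl, h⟩
    exact v.mono' _ _ _ _ le_rfl le_add_self h
  · exact fun h => ⟨0, t, zero_add t, h⟩

end EnergyFun

/-! ## Energy gains -/

theorem energyGain_add (r : ℝ≥0) (d e : ℝ≥0∞) :
    energyGain r (d + e) = energyGain r d + energyGain r e := by
  unfold energyGain
  by_cases hd : d = ∞ <;> by_cases he : e = ∞ <;> simp [hd, he, mul_add]

theorem energyGain_mono {r r' : ℝ≥0} {d d' : ℝ≥0∞} (hr : r ≤ r') (hd : d ≤ d') :
    energyGain r d ≤ energyGain r' d' := by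
  unfold energyGain
  by_cases h' : d' = ∞
  · simp [h']
  · rw [if_neg h', if_neg (ne_top_of_le_ne_top h' hd)]
    gcongr

/-- For `r = 0` the gain jumps at `t = ∞`, where it differs from `r * t`. The jump is upwards, so it
only adds the closed set `t = ∞` to the closed set cut out by the continuous expression. -/
theorem isClosed_le_add_energyGain (r : ℝ≥0) (c : ℝ≥0∞) :
    IsClosed {w : ℝ≥0∞ × ℝ≥0∞ × ℝ≥0∞ | c ≤ w.1 + energyGain r w.2.1} ∧
    IsClosed {w : ℝ≥0∞ × ℝ≥0∞ × ℝ≥0∞ | w.2.2 + c ≤ w.1 + energyGain r w.2.1} := by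
  have hcont : Continuous fun w : ℝ≥0∞ × ℝ≥0∞ × ℝ≥0∞ => w.1 + r * w.2.1 :=
    continuous_fst.add
      ((ENNReal.continuous_const_mul ENNReal.coe_ne_top).comp (by fun_prop))
  have htop : IsClosed {w : ℝ≥0∞ × ℝ≥0∞ × ℝ≥0∞ | w.2.1 = ∞} :=
    isClosed_eq (by fun_prop) continuous_const
  constructor
  · convert (isClosed_le (f := fun _ => c) continuous_const hcont).union htop using 1
    ext ⟨x, t, y⟩
    by_cases ht : t = ∞ <;> simp [energyGain, ht]
  · convert (isClosed_le (f := fun w : ℝ≥0∞ × ℝ≥0∞ × ℝ≥0∞ => w.2.2 + c)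
      (by fun_prop) hcont).union htop using 1
    ext ⟨x, t, y⟩
    by_cases ht : t = ∞ <;> simp [energyGain, ht]

/-! ### Edges, reachability and its closedness -/

namespace RTEA

variable {S : Type*} (A : RTEA S)

/-- A transition from `s` to `s'`, after a delay `t` in `s`, turns energy `x` into energy at
least `y`. -/
def Edge (s s' : S) (x t y : ℝ≥0∞) : Prop :=
  ∃ (p : ℝ) (b : ℝ≥0), (s, p, b, s') ∈ A.transitions ∧
    (b : ℝ≥0∞) ≤ x + energyGain (A.rate s) t ∧
    y + ENNReal.ofReal (-p) ≤ x + energyGain (A.rate s) t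

variable {A}

theorem Edge.mono {s s' : S} {x x' t t' y y' : ℝ≥0∞} (h : A.Edge s s' x t y)
    (hx : x ≤ x') (ht : t ≤ t') (hy : y' ≤ y) : A.Edge s s' x' t' y' := by
  obtain ⟨p, b, hT, h1, h2⟩ := h
  have hg : x + energyGain (A.rate s) t ≤ x' + energyGain (A.rate s) t' :=
    add_le_add hx (energyGain_mono le_rfl ht)
  exact ⟨p, b, hT, h1.trans hg, ((add_le_add_left hy _).trans h2).trans hg⟩

theorem Edge.le {s s' : S} {x t y : ℝ≥0∞} (h : A.Edge s s' x t y) :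
    y ≤ x + energyGain (A.rate s) t := by
  obtain ⟨p, b, -, -, h⟩ := h
  exact le_self_add.trans h

/-- Energy that could have been gained by waiting in `s` is absorbed into the delay before the
transition. -/
theorem Edge.of_add_energyGain {s s' : S} {x t u y : ℝ≥0∞}
    (h : A.Edge s s' (x + energyGain (A.rate s) u) t y) : A.Edge s s' x (u + t) y := by
  simpa only [Edge, energyGain_add, add_assoc] using h

variable (A) in
theorem isHypo_edge (s s' : S) : IsHypo {w | A.Edge s s' w.1 w.2.1 w.2.2} := by
  refine ⟨?_, fun hy h => Edge.mono h le_rfl le_rfl hy⟩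
  have : {w : ℝ≥0∞ × ℝ≥0∞ × ℝ≥0∞ | A.Edge s s' w.1 w.2.1 w.2.2} =
      ⋃ τ ∈ {τ ∈ (A.transitions : Set (S × ℝ × ℝ≥0 × S)) | τ.1 = s ∧ τ.2.2.2 = s'},
        ({w | (τ.2.2.1 : ℝ≥0∞) ≤ w.1 + energyGain (A.rate s) w.2.1} ∩
        {w | w.2.2 + ENNReal.ofReal (-τ.2.1) ≤ w.1 + energyGain (A.rate s) w.2.1}) := by
    ext ⟨x, t, y⟩
    simp only [Set.mem_iUnion]
    constructor
    · rintro ⟨p, b, hT, h⟩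
      exact ⟨(s, p, b, s'), ⟨hT, rfl, rfl⟩, h⟩
    · rintro ⟨⟨_, p, b, _⟩, ⟨hT, rfl, rfl⟩, h⟩
      exact ⟨p, b, hT, h⟩
  rw [this]
  exact (A.transitions.finite_toSet.subset (Set.sep_subset _ _)).isClosed_biUnion fun τ _ =>
    (isClosed_le_add_energyGain _ _).1.inter (isClosed_le_add_energyGain _ _).2

theorem coe_le_M_iff {s s' : S} {x t y : ℝ≥0∞} :
    (y : EnergyLevel) ≤ A.toWeightedAutomaton.M s s' x t ↔ A.Edge s s' x t y := by
  have hat : ∀ {x t y : ℝ≥0∞} p b, (s, p, b, s') ∈ A.transitions →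
      ((y : EnergyLevel) ≤ EnergyFun.atomic (A.rate s) b p x t ↔
        (b : ℝ≥0∞) ≤ x + energyGain (A.rate s) t ∧
          y + ENNReal.ofReal (-p) ≤ x + energyGain (A.rate s) t) := by
    intro x t y p b hT
    -- The condition `b ≥ -p` ensures that the subtraction in `atomic` does not truncate.
    have hpb : ENNReal.ofReal (-p) ≤ b := by
      simpa using ENNReal.ofReal_le_ofReal (A.neg_price_le_bound _ _ _ _ hT)
    simp only [EnergyFun.atomic]
    split_ifs with h
    · rw [WithBot.coe_le_coe, ENNReal.le_sub_iff_add_le_right ENNReal.ofReal_ne_top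
        (hpb.trans h)]
      simp [h]
    · simp [h]
  constructor
  · refine EnergyFun.HypoIn.iSup (R := {w | A.Edge s s' w.1 w.2.1 w.2.2}) (A.isHypo_edge s s')
      (fun p => EnergyFun.HypoIn.iSup (A.isHypo_edge s s') fun b =>
        EnergyFun.HypoIn.iSup (A.isHypo_edge s s') fun hT x t y hy => ?_) x t y
    exact ⟨p, b, hT, (hat p b hT).1 hy⟩
  · rintro ⟨p, b, hT, h⟩
    have hle : EnergyFun.atomic (A.rate s) b p ≤ A.toWeightedAutomaton.M s s' :=
      le_iSup_of_le p (le_iSup_of_le b (le_iSup_of_le hT le_rfl))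
    exact ((hat p b hT).2 h).trans (hle x t)

variable (A) in
/-- A run from `i` with energy `x` to `j` with energy at least `y` in time at most `t`, such that
all states left on the way are in `Q`. -/
inductive Reach (Q : Set S) (i : S) (x : ℝ≥0∞) : S → ℝ≥0∞ → ℝ≥0∞ → Prop
  | refl {t y : ℝ≥0∞} : y ≤ x → Reach Q i x i t y
  | tail {j l : S} {t₁ t₂ y z : ℝ≥0∞} : Reach Q i x j t₁ y → j ∈ Q → A.Edge j l y t₂ z →
      Reach Q i x l (t₁ + t₂) z

theorem Reach.mono {Q Q' : Set S} {i j : S} {x x' t t' y y' : ℝ≥0∞} (h : A.Reach Q i x j t y)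
    (hQ : Q ⊆ Q') (hx : x ≤ x') (ht : t ≤ t') (hy : y' ≤ y) : A.Reach Q' i x' j t' y' := by
  induction h generalizing t' y' with
  | refl h => exact .refl (hy.trans (h.trans hx))
  | @tail j l t₁ t₂ y z _ hj he ih =>
    obtain ⟨u, rfl⟩ := exists_add_of_le ht
    rw [add_assoc]
    exact .tail (ih le_rfl le_rfl) (hQ hj) (he.mono le_rfl le_self_add hy)

theorem Reach.trans {Q : Set S} {i j l : S} {x t₁ t₂ y z : ℝ≥0∞} (h : A.Reach Q i x j t₁ y)
    (h' : A.Reach Q j y l t₂ z) : A.Reach Q i x l (t₁ + t₂) z := by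
  induction h' with
  | refl h' => exact h.mono subset_rfl le_rfl le_self_add h'
  | tail _ hj he ih => rw [← add_assoc]; exact .tail ih hj he

/-- Prices are nonpositive, so the only gains are the delays, each spent in a state of `Q`. -/
theorem Reach.le {Q : Set S} {i j : S} {x t y : ℝ≥0∞} {r : ℝ≥0} (hr : ∀ s ∈ Q, A.rate s ≤ r)
    (h : A.Reach Q i x j t y) : y ≤ x + energyGain r t := by
  induction h with
  | refl h => exact h.trans le_self_add
  | tail _ hj he ih =>
    rw [energyGain_add, ← add_assoc]
    exact he.le.trans (add_le_add ih (energyGain_mono (hr _ hj) le_rfl))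

variable (A) in
/-- The triples `(x, t, y)` for which `Reach` holds. -/
def reachSet (Q : Set S) (i j : S) : Set (ℝ≥0∞ × ℝ≥0∞ × ℝ≥0∞) :=
  {w | A.Reach Q i w.1 j w.2.1 w.2.2}

variable (A) in
/-- The triples `(x, t, y)` for which `Edge` holds. -/
def edgeSet (i j : S) : Set (ℝ≥0∞ × ℝ≥0∞ × ℝ≥0∞) :=
  {w | A.Edge i j w.1 w.2.1 w.2.2}

/-- If `q` has the greatest rate, then it suffices to leave `q` once: delaying in `q` is at least
as good as any loop from `q` to `q`. -/
theorem reachSet_insert {Q : Set S} {q : S} (hq : ∀ s ∈ Q, A.rate s ≤ A.rate q) (i j : S) :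
    A.reachSet (insert q Q) i j = A.reachSet Q i j ∪
      ⋃ l, relComp (relComp (A.reachSet Q i q) (A.edgeSet q l)) (A.reachSet Q l j) := by
  have hsub : Q ⊆ insert q Q := Set.subset_insert q Q
  ext ⟨x, t, y⟩
  simp only [Set.mem_union, Set.mem_iUnion]
  constructor
  · intro h
    replace h : A.Reach (insert q Q) i x j t y := h
    induction h with
    | refl h => exact .inl (.refl h)
    | @tail j l t₁ t₂ y z _ hj he ih =>
      rcases hj with rfl | hj
      · right
        rcases ih with ih | ⟨m, x₂, t₁₂, t₃, ht, ⟨x₁, u₁, u₂, hu, h1, h2⟩, h3⟩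
        · exact ⟨l, z, t₁ + t₂, 0, add_zero _, ⟨y, t₁, t₂, rfl, ih, he⟩, .refl le_rfl⟩
        · simp only at ht hu h1 h2 h3
          subst hu ht
          -- The state of greatest rate (now called `j`) was already left at energy `x₁`. The loop
          -- back to it took time `u₂ + t₃` and gained at most what waiting in `j` gives, so it is
          -- replaced by extra delay before the new edge, which becomes the single exit.
          have hy : y ≤ x₁ + energyGain (A.rate j) (u₂ + t₃) := by
            rw [energyGain_add, ← add_assoc]
            exact (Reach.le hq h3).trans (add_le_add_left (Edge.le h2) _)
          refine ⟨l, z, _, 0, add_zero _, ⟨x₁, u₁, u₂ + t₃ + t₂, ?_, h1,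
            (he.mono hy le_rfl le_rfl).of_add_energyGain⟩, .refl le_rfl⟩
          simp only [add_assoc]
      · rcases ih with ih | ⟨m, x₂, t₁₂, t₃, ht, h12, h3⟩
        · exact .inl (.tail ih hj he)
        · exact .inr ⟨m, x₂, t₁₂, t₃ + t₂, by rw [← add_assoc]; exact congrArg (· + t₂) ht, h12,
            .tail h3 hj he⟩
  · rintro (h | ⟨l, x₂, t₁₂, t₃, ht, ⟨x₁, u₁, u₂, hu, h1, h2⟩, h3⟩)
    · exact Reach.mono h hsub le_rfl le_rfl le_rfl
    · simp only at ht hu h1 h2 h3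
      subst hu ht
      exact Reach.trans (.tail (Reach.mono h1 hsub le_rfl le_rfl le_rfl)
        (Set.mem_insert q Q) h2) (Reach.mono h3 hsub le_rfl le_rfl le_rfl)

variable (A) in
theorem isHypo_reachSet [Finite S] (Q : Set S) (i j : S) : IsHypo (A.reachSet Q i j) := by
  classical
  lift Q to Finset S using Q.toFinite
  -- States are inserted in order of increasing rate, as `reachSet_insert` requires.
  induction Q using Finset.induction_on_max_value A.rate generalizing i j with
  | empty =>
    refine ⟨?_, fun hy h => Reach.mono h subset_rfl le_rfl le_rfl hy⟩
    have h : A.reachSet ((∅ : Finset S) : Set S) i j = {w | i = j ∧ w.2.2 ≤ w.1} := by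
      ext ⟨x, t, y⟩
      constructor
      · intro h
        change A.Reach _ _ _ _ _ _ at h
        cases h with
        | refl h => exact ⟨rfl, h⟩
        | tail _ hj => simp at hj
      · rintro ⟨rfl, h⟩
        exact .refl h
    rw [h]
    by_cases hij : i = j
    · simpa [hij] using isClosed_le (f := fun w : ℝ≥0∞ × ℝ≥0∞ × ℝ≥0∞ => w.2.2) (by fun_prop)
        continuous_fst
    · simp [hij]
  | insert q Q _ hq ih =>
    rw [Finset.coe_insert, reachSet_insert hq]
    exact (ih i j).union (.iUnion fun l => ((ih i q).comp (A.isHypo_edge q l)).comp (ih l j))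

end RTEA


/-! ## Infinite chains -/

/-- If `G` can be reached from `c`, and from each element of `G` again in at least one step, then
there is an infinite chain from `c` that visits `G` infinitely often. -/
theorem exists_chain_of_transGen {α : Type*} {r : α → α → Prop} {G : Set α}
    (hG : ∀ c ∈ G, ∃ c' ∈ G, Relation.TransGen r c c') {c c' : α} (hc' : c' ∈ G)
    (hc : Relation.TransGen r c c') :
    ∃ f : ℕ → α, f 0 = c ∧ (∀ n, r (f n) (f (n + 1))) ∧ {n | f n ∈ G}.Infinite := by
  -- `N m c` says that some path of `m + 1` steps leads from `c` into `G`. Carrying `m` along, each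
  -- step of the chain either enters `G` or lowers the counter.
  let N : ℕ → α → Prop := fun m => Nat.rec (fun c => ∃ d ∈ G, r c d)
    (fun _ P c => ∃ d, r c d ∧ P d) m
  have hN : ∀ {c c'}, c' ∈ G → Relation.TransGen r c c' → ∃ m, N m c := by
    intro c c' hc' h
    induction h using Relation.TransGen.head_induction_on with
    | single h => exact ⟨0, c', hc', h⟩
    | head h _ ih =>
      obtain ⟨m, hm⟩ := ih
      exact ⟨m + 1, _, h, hm⟩
  have hnext : ∀ p : {p : α × ℕ // N p.2 p.1}, ∃ p' : {p : α × ℕ // N p.2 p.1},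
      r p.1.1 p'.1.1 ∧ (p'.1.1 ∈ G ∨ p'.1.2 < p.1.2) := by
    rintro ⟨⟨c, m⟩, h⟩
    cases m with
    | zero =>
      obtain ⟨d, hd, hr⟩ := h
      obtain ⟨d', hd', h'⟩ := hG d hd
      obtain ⟨m, hm⟩ := hN hd' h'
      exact ⟨⟨(d, m), hm⟩, hr, .inl hd⟩
    | succ m =>
      obtain ⟨d, hr, hd⟩ := h
      exact ⟨⟨(d, m), hd⟩, hr, .inr (Nat.lt_succ_self m)⟩
  choose next hr hdec using hnext
  obtain ⟨m, hm⟩ := hN hc' hc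
  let p : ℕ → {p : α × ℕ // N p.2 p.1} := fun n => next^[n] ⟨(c, m), hm⟩
  have hp : ∀ n, p (n + 1) = next (p n) := fun n => Function.iterate_succ_apply' _ _ _
  refine ⟨fun n => (p n).1.1, rfl, fun n => ?_, ?_⟩
  · simpa only [hp] using hr (p n)
  refine Set.infinite_of_not_bddAbove ?_
  rintro ⟨B, hB⟩
  -- If `G` were not visited after time `B`, the counter would decrease forever.
  have hlt : ∀ n, B ≤ n → (p (n + 1)).1.2 < (p n).1.2 := fun n hn => by
    rw [hp]
    refine (hdec (p n)).resolve_left fun hmem => ?_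
    rw [← hp] at hmem
    have := hB hmem
    omega
  have hle : ∀ j, (p (B + j)).1.2 + j ≤ (p B).1.2 := by
    intro j
    induction j with
    | zero => exact le_rfl
    | succ j ih =>
      have := hlt (B + j) (by omega)
      rw [← add_assoc B j 1]
      omega
  have := hle ((p B).1.2 + 1)
  omega

/-! ### Unfolding infinite products and matrix operations -/

namespace EnergyFun

theorem prefixValue_succ' (f : ℕ → EnergyFun) (u : ℕ → ℝ≥0∞) (x : EnergyLevel) (n : ℕ) :
    prefixValue f u x (n + 1) =
      prefixValue (fun i => f (i + 1)) (fun i => u (i + 1)) (f 0 x (u 0)) n := by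
  induction n with
  | zero => rfl
  | succ n ih => rw [prefixValue, ih]; rfl

end EnergyFun

namespace EnergyMatrix

open EnergyFun

variable {ι κ μ : Type*}

theorem mulVec_apply {M : Matrix ι κ EnergyFun} {v : κ → InfBehaviour} {i : ι} {x : EnergyLevel}
    {t : ℝ≥0∞} : mulVec M v i x t ↔ ∃ k t₁ t₂, t₁ + t₂ = t ∧ v k (M i k x t₁) t₂ := by
  rw [mulVec, InfBehaviour.iSup_apply, iSup_Prop_eq]
  exact exists_congr fun k => act_apply

theorem le_mul {M : Matrix ι κ EnergyFun} {N : Matrix κ μ EnergyFun} {i : ι} {j : μ} (k : κ)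
    {x y z : EnergyLevel} {t₁ t₂ : ℝ≥0∞} (hM : y ≤ M i k x t₁) (hN : z ≤ N k j y t₂) :
    z ≤ mul M N i j x (t₁ + t₂) := by
  have h : (M i k).comp (N k j) ≤ mul M N i j := le_iSup (fun k => (M i k).comp (N k j)) k
  exact (le_comp hM hN).trans (h _ _)

theorem HypoIn.mul {M : Matrix ι κ EnergyFun} {N : Matrix κ μ EnergyFun} [Finite κ] {i : ι} {j : μ}
    {R R' : κ → Set (ℝ≥0∞ × ℝ≥0∞ × ℝ≥0∞)} (hR : ∀ k, IsHypo (R k)) (hR' : ∀ k, IsHypo (R' k))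
    (hM : ∀ k, (M i k).HypoIn (R k)) (hN : ∀ k, (N k j).HypoIn (R' k)) :
    (mul M N i j).HypoIn (⋃ k, relComp (R k) (R' k)) :=
  .iSup (.iUnion fun k => (hR k).comp (hR' k)) fun k =>
    ((hM k).comp (hR k) (hR' k) (hN k)).mono (Set.subset_iUnion (fun k => relComp (R k) (R' k)) k)

theorem pathProd_le_star (M : Matrix ι ι EnergyFun) (k : ℕ → ι) (m : ℕ) :
    pathProd M k m ≤ star M (k 0) (k m) :=
  le_iSup_of_le m (le_iSup_of_le k (le_iSup_of_le rfl (le_iSup_of_le rfl le_rfl)))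

theorem omega_apply {M : Matrix ι ι EnergyFun} {i : ι} {x : EnergyLevel} {t : ℝ≥0∞} :
    omega M i x t ↔ ∃ k : ℕ → ι, k 0 = i ∧ infProd (fun n => M (k n) (k (n + 1))) x t := by
  simp [omega, InfBehaviour.iSup_apply]

theorem omega_unfold {M : Matrix ι ι EnergyFun} {i : ι} {x : EnergyLevel} {t : ℝ≥0∞}
    (h : omega M i x t) : ∃ j t₁ t₂, t₁ + t₂ = t ∧ omega M j (M i j x t₁) t₂ := by
  obtain ⟨k, rfl, u, rfl, hu⟩ := omega_apply.1 h
  refine ⟨k 1, u 0, ∑' n, u (n + 1), (tsum_eq_zero_add' ENNReal.summable).symm,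
    omega_apply.2 ⟨fun n => k (n + 1), rfl, fun n => u (n + 1), rfl, fun n => ?_⟩⟩
  have := hu (n + 1)
  rwa [prefixValue_succ'] at this

theorem exists_coe_of_apply {v : InfBehaviour} {x : EnergyLevel} {t : ℝ≥0∞} (h : v x t) :
    ∃ y : ℝ≥0∞, x = y := by
  induction x using WithBot.recBotCoe with
  | bot => rw [v.map_bot'] at h; exact h.elim
  | coe y => exact ⟨y, rfl⟩

end EnergyMatrix

namespace RTEA

open EnergyFun EnergyMatrix

variable {S : Type*} {A : RTEA S}

/-! ## Reachability and steps -/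

/-- Surplus time is spent in the delay, so that exactly `T` remains; surplus energy is kept, so `Y`
may exceed `y`. -/
theorem Edge.exists_step {s s' : S} {x X t T U y : ℝ≥0∞} (h : A.Edge s s' x t y) (hX : x ≤ X)
    (hU : t + T ≤ U) : ∃ Y ≥ y, A.Step (s, X, U) (s', Y, T) := by
  obtain ⟨e, rfl⟩ := exists_add_of_le hU
  obtain ⟨p, b, hT, h1, h2⟩ := h.mono hX (le_self_add (b := e)) le_rfl
  refine ⟨X + energyGain (A.rate s) (t + e) - ENNReal.ofReal (-p),
    ENNReal.le_sub_of_add_le_right ENNReal.ofReal_ne_top h2, t + e, ?_, p, b, hT, h1, ?_⟩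
  · exact add_right_comm t e T
  · exact tsub_add_cancel_of_le (le_add_self.trans h2)

theorem Step.exists_edge {c c' : Config S} (h : A.Step c c') :
    ∃ u, u + c'.2.2 = c.2.2 ∧ A.Edge c.1 c'.1 c.2.1 u c'.2.1 := by
  obtain ⟨d, hd, p, b, hT, h1, h2⟩ := h
  exact ⟨d, hd, p, b, hT, h1, h2.le⟩

/-- The remaining time is only bounded below: `Reach.refl` allows unused time, and an empty run has
no delay in which to spend it. -/
theorem Reach.exists_run {Q : Set S} {i j : S} {x X t T U y : ℝ≥0∞} (h : A.Reach Q i x j t y)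
    (hX : x ≤ X) (hU : t + T ≤ U) :
    ∃ Y ≥ y, ∃ U' ≥ T, Relation.ReflTransGen A.Step (i, X, U) (j, Y, U') := by
  induction h generalizing T with
  | refl h => exact ⟨X, h.trans hX, U, le_add_self.trans hU, .refl⟩
  | @tail j l t₁ t₂ y z _ _ he ih =>
    obtain ⟨Y, hY, U', hU', hrun⟩ := ih (T := t₂ + T) (by rwa [← add_assoc])
    obtain ⟨Z, hZ, hstep⟩ := he.exists_step hY hU'
    exact ⟨Z, hZ, T, le_rfl, hrun.tail hstep⟩

variable (A) in
/-- The triples `(x, t, y)` for which a nonempty run from `i` to `j` through non-accepting states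
turns energy `x` in time `t` into energy at least `y`. -/
def returnSet (i j : S) : Set (ℝ≥0∞ × ℝ≥0∞ × ℝ≥0∞) :=
  A.edgeSet i j ∪ ⋃ l : (A.acceptingᶜ : Set S), relComp (⋃ k : (A.acceptingᶜ : Set S),
    relComp (A.edgeSet i k) (A.reachSet A.acceptingᶜ k l)) (A.edgeSet l j)

theorem exists_run_of_mem_returnSet {i j : S} {x X t T U y : ℝ≥0∞}
    (h : (x, t, y) ∈ A.returnSet i j) (hX : x ≤ X) (hU : t + T ≤ U) :
    ∃ Y ≥ y, Relation.TransGen A.Step (i, X, U) (j, Y, T) := by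
  rcases h with h | h
  · obtain ⟨Y, hY, hs⟩ := Edge.exists_step h hX hU
    exact ⟨Y, hY, .single hs⟩
  · obtain ⟨l, x₂, t₁₂, t₃, ht, h12, h3⟩ := Set.mem_iUnion.1 h
    obtain ⟨k, x₁, t₁, t₂, ht', h1, h2⟩ := Set.mem_iUnion.1 h12
    simp only at ht ht' h1 h2 h3
    subst ht' ht
    rw [add_assoc, add_assoc] at hU
    obtain ⟨Y₁, hY₁, hs₁⟩ := Edge.exists_step h1 hX hU
    obtain ⟨Y₂, hY₂, U₂, hU₂, hs₂⟩ := Reach.exists_run h2 hY₁ le_rfl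
    obtain ⟨Y₃, hY₃, hs₃⟩ := Edge.exists_step h3 hY₂ hU₂
    exact ⟨Y₃, hY₃, (Relation.TransGen.head' hs₁ hs₂).tail hs₃⟩

theorem hypoIn_edgeSet (i j : S) : (A.toWeightedAutomaton.M i j).HypoIn (A.edgeSet i j) :=
  fun _ _ _ => coe_le_M_iff.1

section Finite

variable [Finite S]

/-- Each path product lies in the reachability relation by induction on its length; closedness of
that relation carries this over to the infinite supremum. -/
theorem hypoIn_star (i j : (A.acceptingᶜ : Set S)) :
    (star A.toWeightedAutomaton.d i j).HypoIn (A.reachSet A.acceptingᶜ i j) := by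
  have hpath : ∀ (k : ℕ → (A.acceptingᶜ : Set S)) m,
      (pathProd A.toWeightedAutomaton.d k m).HypoIn (A.reachSet A.acceptingᶜ (k 0) (k m)) := by
    intro k m
    induction m with
    | zero => exact fun x t y h => .refl (WithBot.coe_le_coe.1 h)
    | succ m ih =>
      refine (ih.comp (A.isHypo_reachSet _ _ _) (A.isHypo_edge _ _) (hypoIn_edgeSet _ _)).mono ?_
      rintro ⟨x, t, z⟩ ⟨y, t₁, t₂, rfl, h1, h2⟩
      exact .tail h1 (k m).2 h2
  have hR := A.isHypo_reachSet A.acceptingᶜ i j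
  refine .iSup hR fun m => .iSup hR fun k => .iSup hR fun h0 => .iSup hR fun hm => ?_
  subst h0 hm
  exact hpath k m

theorem hypoIn_returnMatrix (i j : A.toWeightedAutomaton.K) :
    (A.toWeightedAutomaton.returnMatrix i j).HypoIn (A.returnSet i j) := by
  have hbd : ∀ (k : (A.acceptingᶜ : Set S)) l, IsHypo
      (relComp (A.edgeSet i k) (A.reachSet A.acceptingᶜ k l)) := fun k l =>
    (A.isHypo_edge _ _).comp (A.isHypo_reachSet _ _ _)
  have hbdc := HypoIn.mul (N := A.toWeightedAutomaton.c) (j := j)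
    (fun l => IsHypo.iUnion fun k => hbd k l) (fun l => A.isHypo_edge l j)
    (fun l => HypoIn.mul (M := A.toWeightedAutomaton.b) (i := i) (fun k => A.isHypo_edge i k)
      (fun k => A.isHypo_reachSet _ k l) (fun k => hypoIn_edgeSet _ _)
      (fun k => hypoIn_star k l)) (fun l => hypoIn_edgeSet _ _)
  intro x t y h
  rw [WeightedAutomaton.returnMatrix, sup_apply, le_sup_iff] at h
  exact h.imp (hypoIn_edgeSet _ _ x t y) (hbdc x t y)

/-! ## From the Büchi behaviour to a run -/

variable (A) in
/-- The configurations with an accepting state and enough energy and time for the infinite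
behaviour of the return matrix. -/
def liveConfigs : Set (Config S) :=
  {c | ∃ (h : c.1 ∈ A.accepting) (x t : ℝ≥0∞), x ≤ c.2.1 ∧ t ≤ c.2.2 ∧
    omega A.toWeightedAutomaton.returnMatrix ⟨c.1, h⟩ x t}

/-- Splitting off the first factor of the infinite product costs one nonempty run. The slack in
`liveConfigs` absorbs any surplus energy and time. -/
theorem exists_transGen_of_mem_liveConfigs {c : Config S} (hc : c ∈ A.liveConfigs) :
    ∃ c' ∈ A.liveConfigs, Relation.TransGen A.Step c c' := by
  obtain ⟨s, X, U⟩ := c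
  obtain ⟨hs, x, t, hx, ht, h⟩ := hc
  obtain ⟨j, t₁, t₂, rfl, h'⟩ := omega_unfold h
  obtain ⟨y, hy⟩ := exists_coe_of_apply h'
  rw [hy] at h'
  obtain ⟨Y, hY, hrun⟩ := exists_run_of_mem_returnSet (hypoIn_returnMatrix _ j x t₁ y hy.ge) hx ht
  exact ⟨(j, Y, t₂), ⟨j.2, y, t₂, hY, le_rfl, h'⟩, hrun⟩

theorem exists_transGen_of_buchiVec {i : S} {x t : ℝ≥0∞}
    (h : A.toWeightedAutomaton.buchiVec i x t) :
    ∃ c' ∈ A.liveConfigs, Relation.TransGen A.Step (i, x, t) c' := by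
  by_cases hi : i ∈ A.accepting
  · refine exists_transGen_of_mem_liveConfigs ⟨hi, x, t, le_rfl, le_rfl, ?_⟩
    rwa [WeightedAutomaton.buchiVec, dif_pos (show i ∈ A.toWeightedAutomaton.K from hi)] at h
  · rw [WeightedAutomaton.buchiVec, dif_neg (show i ∉ A.toWeightedAutomaton.K from hi)] at h
    obtain ⟨j, t₁, t₂, rfl, h'⟩ := mulVec_apply.1 h
    obtain ⟨y, hy⟩ := exists_coe_of_apply h'
    rw [hy] at h'
    have hmem := HypoIn.mul (M := star A.toWeightedAutomaton.d) (N := A.toWeightedAutomaton.c)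
      (i := ⟨i, hi⟩) (j := j)
      (fun k => A.isHypo_reachSet A.acceptingᶜ i k) (fun k => A.isHypo_edge k j)
      (fun k => hypoIn_star ⟨i, hi⟩ k) (fun k => hypoIn_edgeSet _ _) x t₁ y hy.ge
    obtain ⟨k, z, u₁, u₂, hu, h1, h2⟩ := Set.mem_iUnion.1 hmem
    simp only at hu h1 h2
    subst hu
    obtain ⟨Z, hZ, U', hU', hrun⟩ := Reach.exists_run (X := x) (T := u₂ + t₂) h1 le_rfl
      (add_assoc u₁ u₂ t₂).ge
    obtain ⟨Y, hY, hstep⟩ := Edge.exists_step h2 hZ hU'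
    exact ⟨(j, Y, t₂), ⟨j.2, y, t₂, hY, le_rfl, h'⟩, .tail' hrun hstep⟩

end Finite

theorem buchiBehaviour_apply {x : EnergyLevel} {t : ℝ≥0∞} :
    A.toWeightedAutomaton.buchiBehaviour x t ↔ A.toWeightedAutomaton.buchiVec A.init x t := by
  rw [WeightedAutomaton.buchiBehaviour, InfBehaviour.iSup_apply, iSup_Prop_eq]
  constructor
  · rintro ⟨i, h⟩
    by_cases hi : i = A.init
    · subst hi
      rw [toWeightedAutomaton] at h
      simp only [if_true] at h
      exact one_act.1 h
    · obtain ⟨t₁, t₂, -, h⟩ := act_apply.1 h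
      simp only [toWeightedAutomaton, if_neg hi, bot_apply] at h
      rw [InfBehaviour.map_bot'] at h
      exact h.elim
  · intro h
    refine ⟨A.init, ?_⟩
    have hα : A.toWeightedAutomaton.α A.init = one := if_pos rfl
    rw [hα]
    exact one_act.2 h

/-! ## From a run to the Büchi behaviour -/

theorem IsInfiniteRun.exists_le_star {c : ℕ → Config S} (hc : A.IsInfiniteRun c) {n j : ℕ}
    (h : ∀ i ≤ j, (c (n + i)).1 ∉ A.accepting) :
    ∃ u, u + (c (n + j)).2.2 = (c n).2.2 ∧
      ((c (n + j)).2.1 : EnergyLevel) ≤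
        star A.toWeightedAutomaton.d ⟨(c n).1, h 0 (Nat.zero_le j)⟩
          ⟨(c (n + j)).1, h j le_rfl⟩ (c n).2.1 u := by
  classical
  -- Only indices up to `j` matter; the default value at accepting states just makes `k` total.
  let k : ℕ → (A.acceptingᶜ : Set S) := fun i =>
    if hi : (c (n + i)).1 ∉ A.accepting then ⟨(c (n + i)).1, hi⟩
    else ⟨(c n).1, h 0 (Nat.zero_le j)⟩
  have hk : ∀ i (hi : i ≤ j), k i = ⟨(c (n + i)).1, h i hi⟩ := fun i hi => dif_pos (h i hi)
  have key : ∀ i ≤ j, ∃ u, u + (c (n + i)).2.2 = (c n).2.2 ∧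
      ((c (n + i)).2.1 : EnergyLevel) ≤
        pathProd A.toWeightedAutomaton.d k i (c n).2.1 u := by
    intro i hi
    induction i with
    | zero => exact ⟨0, zero_add _, le_rfl⟩
    | succ i ih =>
      obtain ⟨u, hu, hle⟩ := ih (by omega)
      obtain ⟨v, hv, he⟩ := (hc (n + i)).exists_edge
      have hv' : v + (c (n + (i + 1))).2.2 = (c (n + i)).2.2 := hv
      refine ⟨u + v, by rw [add_assoc, hv', hu], le_comp hle ?_⟩
      rw [hk i (by omega), hk (i + 1) hi]
      exact coe_le_M_iff.2 he
  obtain ⟨u, hu, hle⟩ := key j le_rfl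
  have := hle.trans (pathProd_le_star _ k j _ _)
  rw [hk 0 (Nat.zero_le j), hk j le_rfl] at this
  exact ⟨u, hu, this⟩

theorem IsInfiniteRun.exists_le_returnMatrix {c : ℕ → Config S} (hc : A.IsInfiniteRun c) {n j : ℕ}
    (h0 : (c n).1 ∈ A.accepting) (h : ∀ i < j, (c (n + 1 + i)).1 ∉ A.accepting)
    (hj : (c (n + 1 + j)).1 ∈ A.accepting) :
    ∃ u, u + (c (n + 1 + j)).2.2 = (c n).2.2 ∧
      ((c (n + 1 + j)).2.1 : EnergyLevel) ≤
        A.toWeightedAutomaton.returnMatrix ⟨(c n).1, h0⟩ ⟨_, hj⟩ (c n).2.1 u := by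
  obtain ⟨u, hu, he⟩ := (hc n).exists_edge
  simp only [WeightedAutomaton.returnMatrix, sup_apply]
  -- With no intermediate state the segment is an entry of `a`; otherwise it factors through `b`,
  -- `d^*` and `c`.
  cases j with
  | zero => exact ⟨u, hu, le_sup_of_le_left (coe_le_M_iff.2 he)⟩
  | succ j =>
    obtain ⟨v, hv, hle⟩ := hc.exists_le_star (n := n + 1) (j := j) fun i hi => h i (by omega)
    obtain ⟨w, hw, he'⟩ := (hc (n + 1 + j)).exists_edge
    have hw' : w + (c (n + 1 + (j + 1))).2.2 = (c (n + 1 + j)).2.2 := hw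
    have hb : ((c (n + 1)).2.1 : EnergyLevel) ≤ A.toWeightedAutomaton.b ⟨(c n).1, h0⟩
        ⟨(c (n + 1)).1, h 0 (Nat.succ_pos j)⟩ (c n).2.1 u := coe_le_M_iff.2 he
    have hcw : ((c (n + 1 + (j + 1))).2.1 : EnergyLevel) ≤ A.toWeightedAutomaton.c
        ⟨(c (n + 1 + j)).1, h j (Nat.lt_succ_self j)⟩ ⟨_, hj⟩ (c (n + 1 + j)).2.1 w :=
      coe_le_M_iff.2 he'
    exact ⟨u + v + w, by rw [add_assoc, add_assoc, hw', hv, hu],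
      le_sup_of_le_right (le_mul _ (le_mul _ hb hle) hcw)⟩

theorem IsInfiniteRun.omega_of_infinite {c : ℕ → Config S} (hc : A.IsInfiniteRun c)
    (hinf : {n | (c n).1 ∈ A.accepting}.Infinite) {n : ℕ} (hn : (c n).1 ∈ A.accepting) :
    omega A.toWeightedAutomaton.returnMatrix ⟨(c n).1, hn⟩ (c n).2.1 (c n).2.2 := by
  classical
  let V := {n | (c n).1 ∈ A.accepting}
  have hnext : ∀ n : V, ∃ m : V, ∃ u, u + (c m).2.2 = (c n).2.2 ∧
      ((c m).2.1 : EnergyLevel) ≤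
        A.toWeightedAutomaton.returnMatrix ⟨(c n).1, n.2⟩ ⟨(c m).1, m.2⟩ (c n).2.1 u := by
    rintro ⟨n, hn⟩
    have hex : ∃ j, (c (n + 1 + j)).1 ∈ A.accepting := by
      obtain ⟨m, hm, hlt⟩ := hinf.exists_gt n
      obtain ⟨j, rfl⟩ := Nat.exists_eq_add_of_le (Nat.succ_le_of_lt hlt)
      exact ⟨j, hm⟩
    exact ⟨⟨n + 1 + Nat.find hex, Nat.find_spec hex⟩,
      hc.exists_le_returnMatrix hn (fun i hi => Nat.find_min hex hi) (Nat.find_spec hex)⟩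
  choose next u hu hle using hnext
  let e : ℕ → V := fun m => next^[m] ⟨n, hn⟩
  have he : ∀ m, e (m + 1) = next (e m) := fun m => Function.iterate_succ_apply' _ _ _
  -- The times between consecutive visits telescope, which bounds their infinite sum by the
  -- available time.
  have hsum : ∀ N, ∑ m ∈ Finset.range N, u (e m) + (c (e N)).2.2 = (c n).2.2 := by
    intro N
    induction N with
    | zero => simp [e]
    | succ N ih => rw [Finset.sum_range_succ, add_assoc, he, hu, ih]
  have htsum : ∑' m, u (e m) ≤ (c n).2.2 :=
    ENNReal.tsum_le_of_sum_range_le fun N => le_self_add.trans (hsum N).le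
  refine omega_apply.2 ⟨fun m => ⟨(c (e m)).1, (e m).2⟩, rfl, ?_⟩
  refine (infProd _).mono' _ _ _ _ le_rfl htsum ⟨fun m => u (e m), rfl, fun m => ?_⟩
  have hval : ∀ m, ((c (e m)).2.1 : EnergyLevel) ≤ prefixValue
      (fun m => A.toWeightedAutomaton.returnMatrix ⟨(c (e m)).1, (e m).2⟩
        ⟨(c (e (m + 1))).1, (e (m + 1)).2⟩) (fun m => u (e m)) (c n).2.1 m := by
    intro m
    induction m with
    | zero => exact le_rfl
    | succ m ih =>
      refine le_trans ?_ (EnergyFun.mono' _ _ _ _ _ ih le_rfl)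
      simp only [he]
      exact hle (e m)
  exact ne_bot_of_le_ne_bot WithBot.coe_ne_bot (hval (m + 1))

theorem IsInfiniteRun.buchiVec_of_infinite {c : ℕ → Config S} (hc : A.IsInfiniteRun c)
    (hinf : {n | (c n).1 ∈ A.accepting}.Infinite) :
    A.toWeightedAutomaton.buchiVec (c 0).1 (c 0).2.1 (c 0).2.2 := by
  classical
  by_cases h0 : (c 0).1 ∈ A.accepting
  · rw [WeightedAutomaton.buchiVec, dif_pos (show _ ∈ A.toWeightedAutomaton.K from h0)]
    exact hc.omega_of_infinite hinf h0
  · rw [WeightedAutomaton.buchiVec, dif_neg (show _ ∉ A.toWeightedAutomaton.K from h0)]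
    have hex : ∃ n, (c n).1 ∈ A.accepting := hinf.nonempty
    obtain ⟨n, hn⟩ : ∃ n, Nat.find hex = n + 1 := Nat.exists_eq_succ_of_ne_zero fun h =>
      h0 (h ▸ Nat.find_spec hex)
    have hmin : ∀ i ≤ n, (c (0 + i)).1 ∉ A.accepting := fun i hi => by
      rw [zero_add]
      exact Nat.find_min hex (by omega)
    have hmem : (c (n + 1)).1 ∈ A.accepting := hn ▸ Nat.find_spec hex
    obtain ⟨u, hu, hle⟩ := hc.exists_le_star hmin
    obtain ⟨v, hv, he⟩ := (hc n).exists_edge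
    simp only [zero_add] at hu hle hmin
    have hcv : ((c (n + 1)).2.1 : EnergyLevel) ≤ A.toWeightedAutomaton.c
        ⟨(c n).1, hmin n le_rfl⟩ ⟨(c (n + 1)).1, hmem⟩ (c n).2.1 v := coe_le_M_iff.2 he
    refine mulVec_apply.2 ⟨⟨(c (n + 1)).1, hmem⟩, u + v, (c (n + 1)).2.2, ?_, ?_⟩
    · rw [add_assoc, hv, hu]
    · exact (omega A.toWeightedAutomaton.returnMatrix _).mono' _ _ _ _
        (le_mul _ hle hcv) le_rfl (hc.omega_of_infinite hinf hmem)

end RTEA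

/-- For a real-time energy automaton `A` and `x₀, t ∈ [0, ∞]`: there are an accepting state `s` and
an infinite run from `(s₀, x₀, t)` that visits `s` infinitely often iff `‖A‖ (x₀, t) = ⊤`. -/
theorem theorem5p3 {S : Type*} [Finite S] (A : RTEA S) (x₀ t : ℝ≥0∞) :
    (∃ s ∈ A.accepting, ∃ c : ℕ → RTEA.Config S,
      c 0 = (A.init, x₀, t) ∧ A.IsInfiniteRun c ∧ {n | (c n).1 = s}.Infinite) ↔
    A.toWeightedAutomaton.buchiBehaviour (x₀ : EnergyLevel) t = ⊤ := by
  rw [Prop.top_eq_true, eq_iff_iff, iff_true, RTEA.buchiBehaviour_apply]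
  constructor
  · rintro ⟨s, hs, c, h0, hc, hinf⟩
    have h := hc.buchiVec_of_infinite
      (hinf.mono fun n (hn : (c n).1 = s) => show (c n).1 ∈ A.accepting from hn ▸ hs)
    rwa [h0] at h
  · intro h
    obtain ⟨c', hc', hrun⟩ := RTEA.exists_transGen_of_buchiVec h
    obtain ⟨c, h0, hc, hinf⟩ := exists_chain_of_transGen
      (fun _ => RTEA.exists_transGen_of_mem_liveConfigs) hc' hrun
    by_contra hcon
    push Not at hcon
    -- Pigeonhole: live configurations have accepting states, so if each of these finitely many
    -- states occurred finitely often, so would the live configurations.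
    refine hinf ((A.accepting.toFinite.biUnion fun s hs => hcon s hs c h0 hc).subset ?_)
    rintro n ⟨hn, -⟩
    exact Set.mem_biUnion hn rfl
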